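/- Let $n, d \ge 0$ be integers, let $U(d)$ be the group of unitary complex $d \times d$ matrices, and let $dU$ be its Haar measure, normalized so that $\int_{U(d)} dU = 1$. For a partition $\lambda \vdash n$ let $\ell(\lambda)$ be its number of parts, i.e. the number of rows of its Young diagram, and let $S^\lambda$ be the Specht module of shape $\lambda$, the irreducible complex representation of the symmetric group $S_n$ indexed by $\lambda$; concretely, $S^\lambda$ is the left ideal of $\mathbb{C}[S_n]$ generated by the Young symmetrizer $$\Big(\sum_{\sigma \in R} \sigma\Big)\Big(\sum_{\tau \in C} \operatorname{sgn}(\tau)\,\tau\Big),$$ where the cells of the Young diagram of $\lambda$ are numbered row by row and $R$ and $C$ are the subgroups of permutations that preserve every row, respectively every column, of this numbering. Then $$\int_{U(d)} |\operatorname{tr} U|^{2n} \, dU = \sum_{\substack{\lambda \vdash n \\ \ell(\lambda) \le d}} (\dim S^\lambda)^2 .$$ In particular, no relation between $n$ and $d$ is assumed; the case $n > d$ is included. -/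

import Mathlib

open MeasureTheory

/-! ### The normalized Haar measure on the unitary group -/

/-- The compact unitary group `U(d)` of complex `d × d` matrices. -/
abbrev UnitaryGroup (d : ℕ) : Type := ↥(Matrix.unitaryGroup (Fin d) ℂ)

namespace UnitaryGroup

instance instCompactSpace (d : ℕ) : CompactSpace (UnitaryGroup d) := by
  have hK : IsCompact (Set.pi Set.univ fun _ : Fin d => Set.pi Set.univ
      fun _ : Fin d => Metric.closedBall (0 : ℂ) 1) :=
    isCompact_univ_pi fun _ => isCompact_univ_pi fun _ => isCompact_closedBall _ _
  have hcl : IsClosed (Matrix.unitaryGroup (Fin d) ℂ : Set (Matrix (Fin d) (Fin d) ℂ)) :=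
    isClosed_unitary
  refine isCompact_iff_compactSpace.mp (hK.of_isClosed_subset hcl fun U hU => ?_)
  intro i _ j _
  simpa using entry_norm_bound_of_unitary hU i j

noncomputable instance instMeasurableSpace (d : ℕ) : MeasurableSpace (UnitaryGroup d) := borel _

instance instBorelSpace (d : ℕ) : BorelSpace (UnitaryGroup d) := ⟨rfl⟩

/-- The Haar measure on `U(d)`, normalized to have total mass `1`. -/
noncomputable def haar (d : ℕ) : Measure (UnitaryGroup d) :=
  Measure.haarMeasure ⊤

instance instIsProbabilityMeasureHaar (d : ℕ) : IsProbabilityMeasure (haar d) :=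
  ⟨Measure.haarMeasure_self (K₀ := (⊤ : TopologicalSpace.PositiveCompacts (UnitaryGroup d)))⟩

end UnitaryGroup

/-! ### Specht modules -/

/-- A (bijective) numbering of the cells of the Young diagram `μ` by `n` labels. -/
abbrev YoungNumbering (n : ℕ) (μ : YoungDiagram) : Type := Fin n ≃ ↥μ.cells

namespace YoungNumbering

variable {n : ℕ} {μ : YoungDiagram}

/-- The permutations of the labels that preserve every row of the numbering. -/
def rowStabilizer (T : YoungNumbering n μ) : Subgroup (Equiv.Perm (Fin n)) where
  carrier := {σ | ∀ i, (T (σ i)).1.1 = (T i).1.1}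
  mul_mem' {σ τ} hσ hτ i := (hσ (τ i)).trans (hτ i)
  one_mem' _ := rfl
  inv_mem' {σ} hσ i := by simpa using (hσ (σ⁻¹ i)).symm

/-- The permutations of the labels that preserve every column of the numbering. -/
def columnStabilizer (T : YoungNumbering n μ) : Subgroup (Equiv.Perm (Fin n)) where
  carrier := {σ | ∀ i, (T (σ i)).1.2 = (T i).1.2}
  mul_mem' {σ τ} hσ hτ i := (hσ (τ i)).trans (hτ i)
  one_mem' _ := rfl
  inv_mem' {σ} hσ i := by simpa using (hσ (σ⁻¹ i)).symm

open Classical in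
/-- The Young symmetrizer `(∑ σ) * (∑ sgn(τ) τ)` in the complex group algebra, with `σ` running
over the row stabilizer and `τ` over the column stabilizer. -/
noncomputable def youngSymmetrizer (T : YoungNumbering n μ) :
    MonoidAlgebra ℂ (Equiv.Perm (Fin n)) :=
  (∑ σ : T.rowStabilizer, MonoidAlgebra.single (σ : Equiv.Perm (Fin n)) (1 : ℂ)) *
    ∑ τ : T.columnStabilizer, MonoidAlgebra.single (τ : Equiv.Perm (Fin n))
      (((Equiv.Perm.sign (τ : Equiv.Perm (Fin n)) : ℤˣ) : ℤ) : ℂ)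

end YoungNumbering

namespace Nat.Partition

variable {n : ℕ}

/-- The Young diagram whose row lengths are the parts of the partition in decreasing order. -/
def youngDiagram (p : n.Partition) : YoungDiagram :=
  YoungDiagram.ofRowLens (p.parts.sort (· ≥ ·)) (p.parts.pairwise_sort (· ≥ ·)).sortedGE

theorem card_cellsOfRowLens (w : List ℕ) : (YoungDiagram.cellsOfRowLens w).card = w.sum := by
  induction w with
  | nil => rfl
  | cons a w ih =>
    rw [YoungDiagram.cellsOfRowLens, Finset.card_union_of_disjoint]
    · simp [ih]
    · rw [Finset.disjoint_left]
      rintro ⟨i, j⟩ h h'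
      simp only [Finset.mem_product, Finset.mem_singleton] at h
      simp [h.1] at h'

theorem card_youngDiagram (p : n.Partition) : p.youngDiagram.cells.card = n := by
  have h := congrArg Multiset.sum (p.parts.sort_eq (· ≥ ·))
  rw [Multiset.sum_coe, p.parts_sum] at h
  exact (card_cellsOfRowLens _).trans h

/-- The numbering of the Young diagram of `p` row by row, from left to right in each row. -/
noncomputable def rowNumbering (p : n.Partition) : YoungNumbering n p.youngDiagram :=
  ((p.youngDiagram.cells.map (toLex (α := ℕ × ℕ)).toEmbedding).orderIsoOfFin
    ((Finset.card_map _).trans p.card_youngDiagram)).toEquiv.trans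
    ((ofLex (α := ℕ × ℕ)).subtypeEquiv fun c => by
      simp [Finset.mem_map_equiv])

/-- The Specht module `S^p`: the left ideal of the group algebra `ℂ[S_n]` generated by the Young
symmetrizer of the row numbering of `p`. -/
noncomputable def spechtModule (p : n.Partition) :
    Submodule (MonoidAlgebra ℂ (Equiv.Perm (Fin n))) (MonoidAlgebra ℂ (Equiv.Perm (Fin n))) :=
  Submodule.span _ {p.rowNumbering.youngSymmetrizer}

end Nat.Partition

/-!
The conjugation action of `U(d)` on the operators on `(ℂ ^ d) ^ ⊗ n` has character `|tr U| ^ (2n)`.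
Averaging a representation of a compact group over the Haar measure is a projection onto its fixed
vectors, so the integral is the dimension of the space of operators that commute with all
`U ⊗ ⋯ ⊗ U` (`integral_trace_eq_finrank_fixedVectors`, `finrank_fixedVectors_conjTensorPow`).

By Schur–Weyl duality (`mem_range_tensorAction_iff`) these operators form the image of `ℂ[S_n]`.
Indeed, a homogeneous polynomial in the matrix entries that vanishes on `U(d)` is zero: the Cayley
transform carries it to a polynomial vanishing on the skew-Hermitian matrices, a real form of all
matrices. Hence the `U ⊗ ⋯ ⊗ U` span the operators that commute with `S_n`, and the double commutant
theorem, a consequence of Jacobson density and Maschke's theorem, applies.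

It remains to find the dimension of the image of `ℂ[S_n]`. The Young symmetrizers `c` satisfy
`c x c ∈ ℂ c`, and `c x c' = 0` for different shapes; both follow from one counting argument, the
dominance inequality for a pair of numberings together with its equality case
(`YoungNumbering.card_lt_le`, `YoungNumbering.mem_of_injective`). As there are as many partitions of
`n` as conjugacy classes in `S_n`, the central companions of the Young symmetrizers add up to `1`,
so the image is the product of the algebras `End (S^λ)` over those `λ` whose symmetrizer acts on
tensors by a nonzero operator (`MonoidAlgebra.finrank_range_eq_sum`). These are the `λ` with at most
`d` rows: more rows leave no word of `d` letters with distinct letters in the first column, and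
otherwise the word that labels each cell by its row detects the symmetrizer.
-/

/-! ### Numberings of Young diagrams and the dominance order -/

namespace YoungNumbering

variable {n : ℕ} {μ ν : YoungDiagram}

theorem card_filter (T : YoungNumbering n μ) (P : ℕ × ℕ → Prop) [DecidablePred P] :
    (Finset.univ.filter fun i => P (T i).1).card = (μ.cells.filter P).card := by
  refine Finset.card_bij (fun i _ => (T i).1) ?_ ?_ ?_
  · intro i hi
    simp only [Finset.mem_filter, Finset.mem_univ, true_and] at hi ⊢
    exact ⟨(T i).2, hi⟩
  · intro i _ j _ h
    exact T.injective (Subtype.ext h)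
  · intro c hc
    rw [Finset.mem_filter] at hc
    exact ⟨T.symm ⟨c, hc.1⟩, by simpa using hc.2, by simp⟩

theorem card_row_lt_col_eq (T : YoungNumbering n μ) (k j : ℕ) :
    (Finset.univ.filter fun i => (T i).1.1 < k ∧ (T i).1.2 = j).card = min k (μ.colLen j) := by
  rw [T.card_filter (fun c => c.1 < k ∧ c.2 = j)]
  have : μ.cells.filter (fun c => c.1 < k ∧ c.2 = j) =
      Finset.range (min k (μ.colLen j)) ×ˢ {j} := by
    ext ⟨a, b⟩
    simp only [Finset.mem_filter, YoungDiagram.mem_cells, Finset.mem_product, Finset.mem_range,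
      Finset.mem_singleton, lt_min_iff]
    constructor
    · rintro ⟨h, h1, rfl⟩
      exact ⟨⟨h1, YoungDiagram.mem_iff_lt_colLen.1 h⟩, rfl⟩
    · rintro ⟨⟨h1, h2⟩, rfl⟩
      exact ⟨YoungDiagram.mem_iff_lt_colLen.2 h2, h1, rfl⟩
  rw [this]
  simp

theorem card_col_eq (T : YoungNumbering n μ) (j : ℕ) :
    (Finset.univ.filter fun i => (T i).1.2 = j).card = μ.colLen j := by
  rw [T.card_filter (fun c => c.2 = j), μ.colLen_eq_card]
  rfl

/-- If `r` separates the labels in each column of the relabelled numbering `T ∘ g`, then column `j`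
has at most as many labels with `r < k` as `T` has cells in its first `k` rows. -/
theorem card_lt_col_le (T : YoungNumbering n μ) {r : Fin n → ℕ} {g : Equiv.Perm (Fin n)}
    (h : Function.Injective fun i => (r i, (T (g i)).1.2)) (k j : ℕ) :
    (Finset.univ.filter fun i => r i < k ∧ (T (g i)).1.2 = j).card ≤
      (Finset.univ.filter fun i => (T i).1.1 < k ∧ (T i).1.2 = j).card := by
  rw [card_row_lt_col_eq, le_min_iff]
  constructor
  · rw [← Finset.card_range k]
    refine Finset.card_le_card_of_injOn r ?_ ?_
    · intro i hi
      simp only [Finset.coe_filter, Finset.mem_univ, true_and, Set.mem_ofPred_eq] at hi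
      simpa using hi.1
    · intro a ha b hb hab
      simp only [Finset.coe_filter, Finset.mem_univ, true_and, Set.mem_ofPred_eq] at ha hb
      exact h (Prod.ext hab (ha.2.trans hb.2.symm))
  · rw [← T.card_col_eq j]
    refine Finset.card_le_card_of_injOn g ?_ g.injective.injOn
    intro i hi
    simp only [Finset.coe_filter, Finset.mem_univ, true_and, Set.mem_ofPred_eq] at hi ⊢
    exact hi.2

theorem card_eq_sum_card_col (s q : Fin n → ℕ) (k N : ℕ) (hN : ∀ i, q i < N) :
    (Finset.univ.filter fun i => s i < k).card =
      ∑ j ∈ Finset.range N, (Finset.univ.filter fun i => s i < k ∧ q i = j).card := by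
  rw [Finset.card_eq_sum_card_fiberwise (f := q) (t := Finset.range N)]
  · simp [Finset.filter_filter]
  · intro i _
    simpa using hN i

theorem exists_col_lt (T : YoungNumbering n μ) : ∃ N, ∀ i, (T i).1.2 < N :=
  ⟨_, fun i => Nat.lt_succ_of_le
    (Finset.le_sup (f := fun i => (T i).1.2) (Finset.mem_univ i))⟩

/-- The dominance inequality: if `r` separates the labels in each column of `T ∘ g`, then for
every `k` at most as many labels have `r < k` as `T` has cells in its first `k` rows. -/
theorem card_lt_le (T : YoungNumbering n μ) {r : Fin n → ℕ} {g : Equiv.Perm (Fin n)}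
    (h : Function.Injective fun i => (r i, (T (g i)).1.2)) (k : ℕ) :
    (Finset.univ.filter fun i => r i < k).card ≤
      (Finset.univ.filter fun i => (T i).1.1 < k).card := by
  obtain ⟨N, hN⟩ := T.exists_col_lt
  rw [card_eq_sum_card_col r (fun i => (T (g i)).1.2) k N fun i => hN (g i),
    card_eq_sum_card_col (fun i => (T i).1.1) (fun i => (T i).1.2) k N hN]
  exact Finset.sum_le_sum fun j _ => T.card_lt_col_le h k j

/-- The equality case of the dominance inequality: a `0`-`1` matrix with the row and column sums
of a Young diagram is supported on that diagram. -/
theorem mem_of_injective (T : YoungNumbering n μ) {g : Equiv.Perm (Fin n)}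
    (h : Function.Injective fun i => ((T i).1.1, (T (g i)).1.2)) (i : Fin n) :
    ((T i).1.1, (T (g i)).1.2) ∈ μ := by
  obtain ⟨N, hN⟩ := T.exists_col_lt
  have key : ∀ k j, j < N → (Finset.univ.filter fun i => (T i).1.1 < k ∧ (T (g i)).1.2 = j).card =
      min k (μ.colLen j) := by
    intro k j hj
    rw [← T.card_row_lt_col_eq]
    refine (Finset.sum_eq_sum_iff_of_le fun j _ => T.card_lt_col_le h k j).1 ?_ j
      (Finset.mem_range.2 hj)
    rw [← card_eq_sum_card_col (fun i => (T i).1.1) (fun i => (T (g i)).1.2) k N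
      fun i => hN (g i), ← card_eq_sum_card_col _ _ k N hN]
  rw [YoungDiagram.mem_iff_lt_colLen]
  set k := (T i).1.1 with hk
  set j := (T (g i)).1.2 with hj
  have h1 := key k j (hN _)
  have h2 := key (k + 1) j (hN _)
  have hlt : (Finset.univ.filter fun i => (T i).1.1 < k ∧ (T (g i)).1.2 = j).card <
      (Finset.univ.filter fun i => (T i).1.1 < k + 1 ∧ (T (g i)).1.2 = j).card := by
    refine Finset.card_lt_card (Finset.ssubset_iff_of_subset ?_ |>.2 ⟨i, ?_, ?_⟩)
    · intro a ha
      simp only [Finset.mem_filter, Finset.mem_univ, true_and] at ha ⊢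
      exact ⟨by omega, ha.2⟩
    · simp [← hk, ← hj]
    · simp [← hk]
  rw [h1, h2] at hlt
  omega

theorem card_row_lt (T : YoungNumbering n μ) (k : ℕ) :
    (Finset.univ.filter fun i => (T i).1.1 < k).card = ∑ i ∈ Finset.range k, μ.rowLen i := by
  rw [T.card_filter (fun c => c.1 < k), Finset.card_eq_sum_card_fiberwise (f := Prod.fst)
    (t := Finset.range k)]
  · refine Finset.sum_congr rfl fun i hi => ?_
    rw [Finset.filter_filter, μ.rowLen_eq_card]
    congr 1
    ext c
    simp only [Finset.mem_filter, YoungDiagram.mem_cells, YoungDiagram.mem_row_iff]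
    constructor
    · rintro ⟨h1, -, h2⟩; exact ⟨h1, h2⟩
    · rintro ⟨h1, h2⟩; exact ⟨h1, h2 ▸ Finset.mem_range.1 hi, h2⟩
  · intro c hc
    simpa using (Finset.mem_filter.1 hc).2

/-- Two diagrams that dominate each other are equal. -/
theorem eq_of_card_row_lt (T : YoungNumbering n μ) (T' : YoungNumbering n ν)
    (h : ∀ k, (Finset.univ.filter fun i => (T i).1.1 < k).card =
      (Finset.univ.filter fun i => (T' i).1.1 < k).card) : μ = ν := by
  simp only [card_row_lt] at h
  ext ⟨i, j⟩
  have h1 := h (i + 1)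
  rw [Finset.sum_range_succ, Finset.sum_range_succ, h i, add_right_inj] at h1
  rw [YoungDiagram.mem_cells, YoungDiagram.mem_cells, YoungDiagram.mem_iff_lt_rowLen,
    YoungDiagram.mem_iff_lt_rowLen, h1]

end YoungNumbering

namespace Nat.Partition

variable {n : ℕ}

theorem rowLens_youngDiagram (p : n.Partition) :
    p.youngDiagram.rowLens = p.parts.sort (· ≥ ·) :=
  YoungDiagram.rowLens_ofRowLens_eq_self fun _ hx =>
    p.parts_pos ((Multiset.mem_sort _).1 hx)

theorem youngDiagram_injective : Function.Injective (youngDiagram (n := n)) := by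
  intro p q h
  have h1 := p.rowLens_youngDiagram
  rw [h, q.rowLens_youngDiagram] at h1
  ext1
  rw [← Multiset.sort_eq p.parts (· ≥ ·), ← h1, Multiset.sort_eq]

theorem colLen_youngDiagram_zero (p : n.Partition) :
    p.youngDiagram.colLen 0 = Multiset.card p.parts := by
  rw [← YoungDiagram.length_rowLens, p.rowLens_youngDiagram, Multiset.length_sort]

end Nat.Partition

/-! ### Young symmetrizers -/

namespace YoungNumbering

variable {n : ℕ} {μ ν : YoungDiagram}

open Classical in
/-- The sum of the permutations preserving every row. -/
noncomputable def rowSum (T : YoungNumbering n μ) : MonoidAlgebra ℂ (Equiv.Perm (Fin n)) :=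
  ∑ σ : T.rowStabilizer, MonoidAlgebra.single (σ : Equiv.Perm (Fin n)) (1 : ℂ)

open Classical in
/-- The signed sum of the permutations preserving every column. -/
noncomputable def columnSum (T : YoungNumbering n μ) : MonoidAlgebra ℂ (Equiv.Perm (Fin n)) :=
  ∑ τ : T.columnStabilizer, MonoidAlgebra.single (τ : Equiv.Perm (Fin n))
    (((Equiv.Perm.sign (τ : Equiv.Perm (Fin n)) : ℤˣ) : ℤ) : ℂ)

theorem youngSymmetrizer_eq (T : YoungNumbering n μ) :
    T.youngSymmetrizer = T.rowSum * T.columnSum := rfl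

open Classical in
theorem rowSum_mul_single (T : YoungNumbering n μ) {σ : Equiv.Perm (Fin n)}
    (hσ : σ ∈ T.rowStabilizer) : T.rowSum * MonoidAlgebra.single σ 1 = T.rowSum := by
  rw [rowSum, Finset.sum_mul]
  refine Fintype.sum_equiv (Equiv.mulRight (⟨σ, hσ⟩ : T.rowStabilizer)) _ _ fun x => ?_
  simp [MonoidAlgebra.single_mul_single]

open Classical in
theorem single_mul_rowSum (T : YoungNumbering n μ) {σ : Equiv.Perm (Fin n)}
    (hσ : σ ∈ T.rowStabilizer) : MonoidAlgebra.single σ 1 * T.rowSum = T.rowSum := by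
  rw [rowSum, Finset.mul_sum]
  refine Fintype.sum_equiv (Equiv.mulLeft (⟨σ, hσ⟩ : T.rowStabilizer)) _ _ fun x => ?_
  simp [MonoidAlgebra.single_mul_single]

theorem intCast_sign_mul_self (σ : Equiv.Perm (Fin n)) :
    (((Equiv.Perm.sign σ : ℤˣ) : ℤ) : ℂ) * (((Equiv.Perm.sign σ : ℤˣ) : ℤ) : ℂ) = 1 := by
  rw [← Int.cast_mul, ← Units.val_mul, Int.units_mul_self]
  simp

open Classical in
theorem single_mul_columnSum (T : YoungNumbering n μ) {τ : Equiv.Perm (Fin n)}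
    (hτ : τ ∈ T.columnStabilizer) : MonoidAlgebra.single τ 1 * T.columnSum =
      (((Equiv.Perm.sign τ : ℤˣ) : ℤ) : ℂ) • T.columnSum := by
  rw [columnSum, Finset.mul_sum, Finset.smul_sum]
  refine Fintype.sum_equiv (Equiv.mulLeft (⟨τ, hτ⟩ : T.columnStabilizer)) _ _ fun x => ?_
  simp [MonoidAlgebra.single_mul_single, ← mul_assoc, intCast_sign_mul_self]

open Classical in
theorem columnSum_mul_single (T : YoungNumbering n μ) {τ : Equiv.Perm (Fin n)}
    (hτ : τ ∈ T.columnStabilizer) : T.columnSum * MonoidAlgebra.single τ 1 =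
      (((Equiv.Perm.sign τ : ℤˣ) : ℤ) : ℂ) • T.columnSum := by
  rw [columnSum, Finset.sum_mul, Finset.smul_sum]
  refine Fintype.sum_equiv (Equiv.mulRight (⟨τ, hτ⟩ : T.columnStabilizer)) _ _ fun x => ?_
  simp [MonoidAlgebra.single_mul_single, mul_comm, ← mul_assoc, intCast_sign_mul_self]

theorem swap_mem_rowStabilizer (T : YoungNumbering n μ) {i j : Fin n}
    (h : (T i).1.1 = (T j).1.1) : Equiv.swap i j ∈ T.rowStabilizer := by
  intro k
  by_cases hi : k = i
  · subst hi; simp [h]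
  by_cases hj : k = j
  · subst hj; simp [h]
  rw [Equiv.swap_apply_of_ne_of_ne hi hj]

theorem swap_mem_columnStabilizer (T : YoungNumbering n μ) {i j : Fin n}
    (h : (T i).1.2 = (T j).1.2) : Equiv.swap i j ∈ T.columnStabilizer := by
  intro k
  by_cases hi : k = i
  · subst hi; simp [h]
  by_cases hj : k = j
  · subst hj; simp [h]
  rw [Equiv.swap_apply_of_ne_of_ne hi hj]

theorem single_swap_mul_columnSum (T : YoungNumbering n μ) {i j : Fin n} (hij : i ≠ j)
    (h : (T i).1.2 = (T j).1.2) :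
    MonoidAlgebra.single (Equiv.swap i j) 1 * T.columnSum = -T.columnSum := by
  rw [T.single_mul_columnSum (T.swap_mem_columnStabilizer h), Equiv.Perm.sign_swap hij]
  simp

theorem columnSum_mul_single_swap (T : YoungNumbering n μ) {i j : Fin n} (hij : i ≠ j)
    (h : (T i).1.2 = (T j).1.2) :
    T.columnSum * MonoidAlgebra.single (Equiv.swap i j) 1 = -T.columnSum := by
  rw [T.columnSum_mul_single (T.swap_mem_columnStabilizer h), Equiv.Perm.sign_swap hij]
  simp

theorem eq_zero_of_eq_neg {x : MonoidAlgebra ℂ (Equiv.Perm (Fin n))} (h : x = -x) : x = 0 := by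
  have h2 : (2 : ℂ) • x = 0 := by
    rw [two_smul, add_eq_zero_iff_eq_neg]
    exact h
  exact (smul_eq_zero.1 h2).resolve_left two_ne_zero

/-- If two labels share a row of `T` and a column of `T' ∘ g⁻¹`, their transposition is absorbed
with sign `1` on the left and `-1` on the right. -/
theorem rowSum_mul_single_mul_columnSum_eq_zero (T : YoungNumbering n μ) (T' : YoungNumbering n ν)
    {g : Equiv.Perm (Fin n)}
    (h : ¬ Function.Injective fun i => ((T i).1.1, (T' (g⁻¹ i)).1.2)) :
    T.rowSum * MonoidAlgebra.single g 1 * T'.columnSum = 0 := by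
  simp only [Function.Injective, Prod.mk.injEq] at h
  push Not at h
  obtain ⟨i, j, ⟨h1, h2⟩, hij⟩ := h
  refine eq_zero_of_eq_neg ?_
  calc T.rowSum * MonoidAlgebra.single g 1 * T'.columnSum
      = T.rowSum * MonoidAlgebra.single (Equiv.swap i j) 1 * MonoidAlgebra.single g 1 *
          T'.columnSum := by rw [T.rowSum_mul_single (T.swap_mem_rowStabilizer h1)]
    _ = T.rowSum * MonoidAlgebra.single g 1 *
          (MonoidAlgebra.single (Equiv.swap (g⁻¹ i) (g⁻¹ j)) 1 * T'.columnSum) := by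
        simp only [← mul_assoc]
        rw [mul_assoc T.rowSum _ (.single g 1), mul_assoc T.rowSum (.single g 1),
          MonoidAlgebra.single_mul_single, MonoidAlgebra.single_mul_single,
          Equiv.mul_swap_eq_swap_mul]
        simp
    _ = _ := by
        rw [T'.single_swap_mul_columnSum (fun h => hij (g⁻¹.injective h)) h2, mul_neg]

theorem columnSum_mul_single_mul_rowSum_eq_zero (T : YoungNumbering n μ) (T' : YoungNumbering n ν)
    {g : Equiv.Perm (Fin n)}
    (h : ¬ Function.Injective fun i => ((T' i).1.1, (T (g i)).1.2)) :
    T.columnSum * MonoidAlgebra.single g 1 * T'.rowSum = 0 := by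
  simp only [Function.Injective, Prod.mk.injEq] at h
  push Not at h
  obtain ⟨i, j, ⟨h1, h2⟩, hij⟩ := h
  refine eq_zero_of_eq_neg ?_
  calc T.columnSum * MonoidAlgebra.single g 1 * T'.rowSum
      = T.columnSum * MonoidAlgebra.single g 1 * (MonoidAlgebra.single (Equiv.swap i j) 1 *
          T'.rowSum) := by rw [T'.single_mul_rowSum (T'.swap_mem_rowStabilizer h1)]
    _ = T.columnSum * MonoidAlgebra.single (Equiv.swap (g i) (g j)) 1 *
          MonoidAlgebra.single g 1 * T'.rowSum := by
        simp only [← mul_assoc]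
        rw [mul_assoc T.columnSum (.single g 1), mul_assoc T.columnSum _ (.single g 1),
          MonoidAlgebra.single_mul_single, MonoidAlgebra.single_mul_single,
          Equiv.mul_swap_eq_swap_mul]
    _ = _ := by
        rw [T.columnSum_mul_single_swap (fun h => hij (g.injective h)) h2]
        simp only [neg_mul]

theorem rowSum_mul_single_mul_columnSum (T : YoungNumbering n μ) (g : Equiv.Perm (Fin n)) :
    ∃ s : ℂ, T.rowSum * MonoidAlgebra.single g 1 * T.columnSum = s • T.youngSymmetrizer := by
  by_cases h : Function.Injective fun i => ((T i).1.1, (T (g⁻¹ i)).1.2)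
  · -- In this case `g` factors as `σ⁻¹ * τ` with `σ` preserving the rows and `τ` the columns:
    -- `σ` moves the label `i` to the cell in the row of `T i` and the column of `T (g⁻¹ i)`.
    have hmem := T.mem_of_injective h
    let s : Fin n → Fin n := fun i => T.symm ⟨((T i).1.1, (T (g⁻¹ i)).1.2), hmem i⟩
    have hs : ∀ i, (T (s i)).1 = ((T i).1.1, (T (g⁻¹ i)).1.2) := fun i => by simp [s]
    have hinj : Function.Injective s := fun i j hij => h (by
      have := congrArg (fun k => (T k).1) hij
      simpa only [hs] using this)
    let σ : Equiv.Perm (Fin n) := Equiv.ofBijective s (Finite.injective_iff_bijective.1 hinj)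
    have hσ : σ ∈ T.rowStabilizer := fun i => by
      simpa [σ] using congrArg Prod.fst (hs i)
    have hτ : σ * g ∈ T.columnStabilizer := fun i => by
      simpa [σ] using congrArg Prod.snd (hs (g i))
    refine ⟨(((Equiv.Perm.sign (σ * g) : ℤˣ) : ℤ) : ℂ), ?_⟩
    rw [youngSymmetrizer_eq, ← mul_smul_comm, ← T.single_mul_columnSum hτ, ← mul_assoc,
      ← T.rowSum_mul_single hσ, mul_assoc T.rowSum, MonoidAlgebra.single_mul_single, mul_one,
      T.rowSum_mul_single hσ]
  · exact ⟨0, by rw [T.rowSum_mul_single_mul_columnSum_eq_zero T h, zero_smul]⟩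

theorem rowSum_mul_mul_columnSum (T : YoungNumbering n μ)
    (x : MonoidAlgebra ℂ (Equiv.Perm (Fin n))) :
    ∃ s : ℂ, T.rowSum * x * T.columnSum = s • T.youngSymmetrizer := by
  induction x using MonoidAlgebra.induction_on with
  | of g => exact T.rowSum_mul_single_mul_columnSum g
  | add x y hx hy =>
    obtain ⟨s, hs⟩ := hx
    obtain ⟨t, ht⟩ := hy
    exact ⟨s + t, by rw [mul_add, add_mul, hs, ht, add_smul]⟩
  | smul r x hx =>
    obtain ⟨s, hs⟩ := hx
    exact ⟨r * s, by rw [mul_smul_comm, smul_mul_assoc, hs, smul_smul]⟩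

/-- Up to a scalar the Young symmetrizer is a primitive idempotent: it cuts the group algebra down
to the multiples of itself. -/
theorem youngSymmetrizer_mul_mul_self (T : YoungNumbering n μ)
    (x : MonoidAlgebra ℂ (Equiv.Perm (Fin n))) :
    ∃ s : ℂ, T.youngSymmetrizer * x * T.youngSymmetrizer = s • T.youngSymmetrizer := by
  obtain ⟨s, hs⟩ := T.rowSum_mul_mul_columnSum (T.columnSum * x * T.rowSum)
  exact ⟨s, by rw [← hs]; simp only [youngSymmetrizer_eq, mul_assoc]⟩

/-- Young symmetrizers of different shapes are orthogonal: a nonzero product would make the two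
shapes dominate each other. -/
theorem youngSymmetrizer_mul_mul_eq_zero (T : YoungNumbering n μ) (T' : YoungNumbering n ν)
    (h : μ ≠ ν) (x : MonoidAlgebra ℂ (Equiv.Perm (Fin n))) :
    T.youngSymmetrizer * x * T'.youngSymmetrizer = 0 := by
  by_cases h1 : ∀ g, T.rowSum * MonoidAlgebra.single g 1 * T'.columnSum = 0
  · have h2 : ∀ y, T.rowSum * y * T'.columnSum = 0 := by
      intro y
      induction y using MonoidAlgebra.induction_on with
      | of g => exact h1 g
      | add x y hx hy => rw [mul_add, add_mul, hx, hy, add_zero]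
      | smul r x hx => rw [mul_smul_comm, smul_mul_assoc, hx, smul_zero]
    have := h2 (T.columnSum * x * T'.rowSum)
    simpa only [youngSymmetrizer_eq, mul_assoc] using this
  · push Not at h1
    obtain ⟨g, hg⟩ := h1
    have hle := T'.card_lt_le
      (not_not.1 fun h => hg (T.rowSum_mul_single_mul_columnSum_eq_zero T' h))
    have h2 : ∀ y, T.columnSum * y * T'.rowSum = 0 := by
      intro y
      induction y using MonoidAlgebra.induction_on with
      | of g' =>
        by_contra hg'
        have hle' := T.card_lt_le
          (not_not.1 fun h => hg' (T.columnSum_mul_single_mul_rowSum_eq_zero T' h))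
        exact h (T.eq_of_card_row_lt T' fun k => le_antisymm (hle k) (hle' k))
      | add x y hx hy => rw [mul_add, add_mul, hx, hy, add_zero]
      | smul r x hx => rw [mul_smul_comm, smul_mul_assoc, hx, smul_zero]
    calc T.youngSymmetrizer * x * T'.youngSymmetrizer
        = T.rowSum * (T.columnSum * x * T'.rowSum) * T'.columnSum := by
          simp only [youngSymmetrizer_eq, mul_assoc]
      _ = 0 := by rw [h2, mul_zero, zero_mul]

theorem eq_one_of_mem_rowStabilizer_of_mem_columnStabilizer (T : YoungNumbering n μ)
    {σ : Equiv.Perm (Fin n)} (h : σ ∈ T.rowStabilizer) (h' : σ ∈ T.columnStabilizer) : σ = 1 :=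
  Equiv.ext fun i => T.injective (Subtype.ext (Prod.ext (h i) (h' i)))

open Classical in
theorem coeff_youngSymmetrizer_one (T : YoungNumbering n μ) :
    T.youngSymmetrizer.coeff 1 = 1 := by
  rw [youngSymmetrizer, Finset.sum_mul_sum]
  simp only [MonoidAlgebra.single_mul_single, MonoidAlgebra.coeff_sum, Finsupp.finsetSum_apply,
    MonoidAlgebra.coeff_single, Finsupp.single_apply, one_mul]
  rw [Finset.sum_eq_single 1, Finset.sum_eq_single 1]
  · simp
  · intro τ _ hτ
    refine if_neg fun h => hτ ?_
    ext1
    simpa using h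
  · simp
  · intro σ _ hσ
    refine Finset.sum_eq_zero fun τ _ => if_neg fun h => hσ ?_
    ext1
    refine T.eq_one_of_mem_rowStabilizer_of_mem_columnStabilizer σ.2 ?_
    rw [eq_inv_of_mul_eq_one_left h]
    exact inv_mem τ.2
  · simp

end YoungNumbering

/-! ### Central idempotents of the group algebra -/

/-- The double commutant theorem, for a semisimple module that is finite-dimensional over a
field: a linear map that commutes with all module endomorphisms is the action of a scalar. -/
theorem exists_smul_eq_of_commute_end {k B M : Type*} [Field k] [Ring B] [Algebra k B]
    [AddCommGroup M] [Module k M] [Module B M] [IsScalarTower k B M] [IsSemisimpleModule B M]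
    [Module.Finite k M] (T : M →ₗ[k] M)
    (h : ∀ (φ : Module.End B M) (m : M), T (φ m) = φ (T m)) : ∃ b : B, ∀ m, T m = b • m := by
  let f : Module.End (Module.End B M) M :=
    { toFun := T, map_add' := T.map_add, map_smul' := fun φ m => h φ m }
  obtain ⟨s, hs⟩ := Module.Finite.fg_top (R := k) (M := M)
  obtain ⟨b, hb⟩ := jacobson_density f s
  refine ⟨b, fun m => ?_⟩
  have hm : m ∈ Submodule.span k (s : Set M) := hs ▸ Submodule.mem_top
  induction hm using Submodule.span_induction with
  | mem x hx => exact hb x hx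
  | zero => simp
  | add x y _ _ hx hy => rw [map_add, hx, hy, smul_add]
  | smul a x _ hx => rw [map_smul, hx, smul_algebra_smul_comm]

namespace MonoidAlgebra

variable {G : Type*} [Group G]

theorem mul_comm_of_forall_single {z : MonoidAlgebra ℂ G}
    (h : ∀ g, single g 1 * z = z * single g 1) (x : MonoidAlgebra ℂ G) : x * z = z * x := by
  induction x using MonoidAlgebra.induction_on with
  | of g => exact h g
  | add x y hx hy => rw [add_mul, mul_add, hx, hy]
  | smul r x hx => rw [smul_mul_assoc, mul_smul_comm, hx]

theorem coeff_single_mul_mul_single (g : G) (x : MonoidAlgebra ℂ G) (a : G) :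
    (single g 1 * x * single g⁻¹ 1 : MonoidAlgebra ℂ G).coeff (g * a * g⁻¹) = x.coeff a := by
  induction x using MonoidAlgebra.induction_on with
  | of b =>
    classical
    simp [MonoidAlgebra.single_mul_single, Finsupp.single_apply]
  | add x y hx hy => simp [mul_add, add_mul, hx, hy]
  | smul r x hx => simp [hx]

variable {Λ : Type*}

/-- Two linear maps with the same kernel have images of the same dimension; here the first one is
onto a product of matrix algebras. -/
theorem finrank_range_eq_sum_sq {ι B A : Type*} {V : ι → Type*} [Fintype ι] [AddCommGroup B]
    [Module ℂ B] [AddCommGroup A] [Module ℂ A] [Module.Finite ℂ B] [∀ l, AddCommGroup (V l)]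
    [∀ l, Module ℂ (V l)] [∀ l, Module.Finite ℂ (V l)] (f : B →ₗ[ℂ] ((l : ι) → V l →ₗ[ℂ] V l))
    (g : B →ₗ[ℂ] A) (hf : Function.Surjective f) (hfg : LinearMap.ker f = LinearMap.ker g) :
    Module.finrank ℂ (LinearMap.range g) = ∑ l, Module.finrank ℂ (V l) ^ 2 := by
  have h1 := LinearMap.finrank_range_add_finrank_ker g
  have h2 := LinearMap.finrank_range_add_finrank_ker f
  rw [hfg, LinearMap.range_eq_top.2 hf, finrank_top, Module.finrank_pi_fintype] at h2
  simp only [Module.finrank_linearMap, ← sq] at h2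
  omega

/-- The dimension of the center of the group algebra is at most the number of conjugacy classes;
here the classes are separated by an invariant `κ` with values in `Λ`. -/
theorem finrank_center_le [Fintype Λ] (κ : G → Λ) (hκ : ∀ g h, κ g = κ h → IsConj g h) :
    Module.finrank ℂ (Subalgebra.center ℂ (MonoidAlgebra ℂ G)) ≤ Fintype.card Λ := by
  let r : Λ → G := Function.invFun κ
  let Φ : Subalgebra.center ℂ (MonoidAlgebra ℂ G) →ₗ[ℂ] (Λ → ℂ) :=
    { toFun := fun z l => z.1.coeff (r l)
      map_add' := fun _ _ => rfl
      map_smul' := fun _ _ => rfl }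
  have hΦ : Function.Injective Φ := by
    rw [injective_iff_map_eq_zero]
    intro z hz
    have hz' := Subalgebra.mem_center_iff.1 z.2
    refine Subtype.ext (MonoidAlgebra.ext (Finsupp.ext fun g => ?_))
    have h1 : κ (r (κ g)) = κ g := Function.invFun_eq ⟨g, rfl⟩
    obtain ⟨a, ha⟩ := isConj_iff.1 (hκ _ _ h1)
    have h2 := coeff_single_mul_mul_single a z.1 (r (κ g))
    rw [hz', mul_assoc, single_mul_single, ha] at h2
    simp only [mul_inv_cancel, mul_one] at h2
    rw [← one_def, mul_one] at h2
    rw [h2]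
    exact congrFun hz (κ g)
  simpa using LinearMap.finrank_le_finrank_of_injective hΦ

/-- The action of the group algebra on the family of left ideals generated by the `c l`. -/
noncomputable def actionOnSpans {ι : Type*} (c : ι → MonoidAlgebra ℂ G) :
    MonoidAlgebra ℂ G →ₗ[ℂ] ((l : ι) → Submodule.span (MonoidAlgebra ℂ G) {c l} →ₗ[ℂ]
      Submodule.span (MonoidAlgebra ℂ G) {c l}) :=
  LinearMap.pi fun l =>
    (Algebra.lsmul ℂ ℂ (Submodule.span (MonoidAlgebra ℂ G) {c l})).toLinearMap

theorem coe_actionOnSpans_apply {ι : Type*} (c : ι → MonoidAlgebra ℂ G) (b : MonoidAlgebra ℂ G)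
    (l : ι) (m : Submodule.span (MonoidAlgebra ℂ G) {c l}) :
    (actionOnSpans c b l m : MonoidAlgebra ℂ G) = b * m := rfl

section Finite

variable [Finite G]

/-- By Maschke's theorem, a left ideal with zero multiplication is zero: it is generated by an
idempotent. -/
theorem submodule_eq_bot_of_mul_eq_zero (N : Submodule (MonoidAlgebra ℂ G) (MonoidAlgebra ℂ G))
    (h : ∀ x ∈ N, ∀ y ∈ N, x * y = 0) : N = ⊥ := by
  obtain ⟨N', hN'⟩ := MonoidAlgebra.Submodule.exists_isCompl N
  have h1 : (1 : MonoidAlgebra ℂ G) ∈ N ⊔ N' := hN'.sup_eq_top ▸ Submodule.mem_top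
  obtain ⟨e, he, f, hf, hef⟩ := Submodule.mem_sup.1 h1
  refine (Submodule.eq_bot_iff _).2 fun x hx => ?_
  have h2 : x * e = 0 := h x hx e he
  have h3 : x = x * f := by
    rw [← zero_add (x * f), ← h2, ← mul_add, hef, mul_one]
  have h4 : x ∈ N' := by
    rw [h3]
    exact N'.smul_mem x hf
  exact (Submodule.disjoint_def.1 hN'.disjoint) x hx h4

theorem eq_zero_of_mul_mul_self_eq_zero {c : MonoidAlgebra ℂ G} (h : ∀ x, c * x * c = 0) :
    c = 0 := by
  have := submodule_eq_bot_of_mul_eq_zero (Submodule.span _ {c}) (by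
    intro x hx y hy
    obtain ⟨a, rfl⟩ := Submodule.mem_span_singleton.1 hx
    obtain ⟨b, rfl⟩ := Submodule.mem_span_singleton.1 hy
    rw [smul_eq_mul, smul_eq_mul, mul_assoc, ← mul_assoc c, h, mul_zero])
  rwa [Submodule.span_singleton_eq_bot] at this

theorem exists_mul_mul_self_eq {c : MonoidAlgebra ℂ G} (hc : c ≠ 0)
    (h : ∀ x, ∃ s : ℂ, c * x * c = s • c) : ∃ x, c * x * c = c := by
  by_contra! hcon
  refine hc (eq_zero_of_mul_mul_self_eq_zero fun x => ?_)
  obtain ⟨s, hs⟩ := h x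
  by_cases h0 : s = 0
  · rw [hs, h0, zero_smul]
  · refine absurd ?_ (hcon (s⁻¹ • x))
    rw [mul_smul_comm, smul_mul_assoc, hs, smul_smul, inv_mul_cancel₀ h0, one_smul]

/-- Every linear endomorphism of the simple module `ℂ[G] c` is the action of a group algebra
element. -/
theorem exists_smul_eq_of_linearMap {c : MonoidAlgebra ℂ G} (hc : c ≠ 0)
    (h : ∀ x, ∃ s : ℂ, c * x * c = s • c)
    (T : Submodule.span (MonoidAlgebra ℂ G) {c} →ₗ[ℂ] Submodule.span (MonoidAlgebra ℂ G) {c}) :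
    ∃ b : MonoidAlgebra ℂ G, ∀ m, T m = b • m := by
  refine exists_smul_eq_of_commute_end T fun φ m => ?_
  -- By Schur's lemma, `φ` is a scalar.
  obtain ⟨x, hx⟩ := exists_mul_mul_self_eq hc h
  let v : Submodule.span (MonoidAlgebra ℂ G) {c} := ⟨c, Submodule.mem_span_singleton_self c⟩
  obtain ⟨y, hy⟩ := Submodule.mem_span_singleton.1 (φ v).2
  obtain ⟨s, hs⟩ := h (x * y)
  have hv : (c * x) • v = v := Subtype.ext hx
  have hφv : φ v = s • v := by
    refine Subtype.ext ?_
    rw [← hv, map_smul]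
    change c * x * (φ v : MonoidAlgebra ℂ G) = s • (c * x * c)
    rw [← hy, hx, ← hs, smul_eq_mul]
    simp only [mul_assoc]
  have hφ : ∀ w, φ w = s • w := by
    intro w
    obtain ⟨a, ha⟩ := Submodule.mem_span_singleton.1 w.2
    have : w = a • v := Subtype.ext ha.symm
    rw [this, map_smul, hφv, smul_comm]
  rw [hφ, hφ, map_smul]

/-- The kernel of an algebra homomorphism that does not kill `c` acts by zero on `ℂ[G] c`. -/
theorem mul_eq_zero_of_map_eq_zero {A : Type*} [Ring A] [Algebra ℂ A]
    (ρ : MonoidAlgebra ℂ G →ₐ[ℂ] A) {c : MonoidAlgebra ℂ G}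
    (h : ∀ x, ∃ s : ℂ, c * x * c = s • c) (hρ : ρ c ≠ 0) {b m : MonoidAlgebra ℂ G} (hb : ρ b = 0)
    (hm : m ∈ Submodule.span (MonoidAlgebra ℂ G) {c}) : b * m = 0 := by
  -- The elements of the left ideal killed by `ρ` form a left ideal with zero multiplication.
  let N : Submodule (MonoidAlgebra ℂ G) (MonoidAlgebra ℂ G) :=
    Submodule.span (MonoidAlgebra ℂ G) {c} ⊓ RingHom.ker ρ.toRingHom
  have hN : N = ⊥ := by
    refine submodule_eq_bot_of_mul_eq_zero N ?_
    rintro x ⟨hx, -⟩ y ⟨hy, hy'⟩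
    obtain ⟨x, rfl⟩ := Submodule.mem_span_singleton.1 hx
    obtain ⟨y, rfl⟩ := Submodule.mem_span_singleton.1 hy
    obtain ⟨s, hs⟩ := h y
    have hy'' : ρ (y * c) = 0 := hy'
    have h1 : s • ρ c = 0 := by
      rw [← map_smul, ← hs, mul_assoc, map_mul, hy'', mul_zero]
    have hs0 : s = 0 := (smul_eq_zero.1 h1).resolve_right hρ
    rw [smul_eq_mul, smul_eq_mul, mul_assoc, ← mul_assoc c, hs, hs0, zero_smul, mul_zero]
  have hm : b * m ∈ N := by
    refine ⟨Submodule.smul_mem _ b hm, ?_⟩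
    change ρ (b * m) = 0
    rw [map_mul, hb, zero_mul]
  rwa [hN, Submodule.mem_bot] at hm

end Finite

variable [Fintype G]

/-- Every `c` that cuts the group algebra down to its multiples, and has a nonzero coefficient
at `1`, has a central companion `e` with `e * c = c`, namely a multiple of the sum of the
conjugates of `c`. -/
theorem exists_central {c : MonoidAlgebra ℂ G} (hc : c.coeff 1 ≠ 0)
    (h : ∀ x, ∃ s : ℂ, c * x * c = s • c) :
    ∃ e : MonoidAlgebra ℂ G, (∀ x, x * e = e * x) ∧ e * c = c ∧
      ∃ t : ℂ, e = t • ∑ g : G, single g 1 * c * single g⁻¹ 1 := by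
  set z : MonoidAlgebra ℂ G := ∑ g : G, single g 1 * c * single g⁻¹ 1 with hz
  have hcomm : ∀ x, x * z = z * x := by
    refine mul_comm_of_forall_single fun g => ?_
    rw [hz, Finset.mul_sum, Finset.sum_mul]
    refine Fintype.sum_equiv (Equiv.mulLeft g) _ _ fun a => ?_
    simp only [Equiv.coe_mulLeft, mul_inv_rev, ← mul_assoc, single_mul_single, one_mul]
    rw [mul_assoc _ (single (a⁻¹ * g⁻¹) 1) (single g 1), single_mul_single]
    simp
  have hz0 : z ≠ 0 := by
    intro h0
    have h1 : z.coeff 1 = Fintype.card G * c.coeff 1 := by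
      rw [hz, coeff_sum, Finsupp.finsetSum_apply]
      have : ∀ g : G, (single g 1 * c * single g⁻¹ 1 : MonoidAlgebra ℂ G).coeff 1 =
          c.coeff 1 := fun g => by
        have := coeff_single_mul_mul_single g c 1
        rwa [mul_one, mul_inv_cancel] at this
      simp [this]
    rw [h0] at h1
    simp [hc] at h1
  have hc0 : c ≠ 0 := fun h0 => hc (by simp [h0])
  obtain ⟨x, hx⟩ := exists_mul_mul_self_eq hc0 h
  obtain ⟨s, hs⟩ := h (z * x)
  have hzc : z * c = s • c := by
    rw [← hs, ← mul_assoc c, hcomm c, mul_assoc z c, mul_assoc z, hx]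
  have hs0 : s ≠ 0 := by
    rintro rfl
    rw [zero_smul] at hzc
    -- In this case `z` would be a central element with `z * z = 0`.
    refine hz0 (eq_zero_of_mul_mul_self_eq_zero fun y => ?_)
    have hzz : z * z = 0 := by
      -- Each conjugate of `c` is annihilated by `z`, because `z` is central.
      nth_rewrite 2 [hz]
      rw [Finset.mul_sum]
      refine Finset.sum_eq_zero fun g _ => ?_
      rw [← mul_assoc, ← mul_assoc, ← hcomm, mul_assoc (single g 1), hzc, mul_zero, zero_mul]
    rw [← hcomm, mul_assoc, hzz, mul_zero]
  refine ⟨s⁻¹ • z, fun x => ?_, ?_, s⁻¹, rfl⟩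
  · rw [mul_smul_comm, smul_mul_assoc, hcomm]
  · rw [smul_mul_assoc, hzc, smul_smul, inv_mul_cancel₀ hs0, one_smul]

variable [Fintype Λ] {c : Λ → MonoidAlgebra ℂ G}

/-- If there are as many pairwise orthogonal elements `c l` as conjugacy classes, each cutting the
group algebra down to its multiples, then their central companions decompose `1`: they are linearly
independent, hence a basis of the center. -/
theorem exists_central_decomposition (hc : ∀ l, (c l).coeff 1 ≠ 0)
    (h : ∀ l x, ∃ s : ℂ, c l * x * c l = s • c l) (h' : ∀ l m, l ≠ m → ∀ x, c l * x * c m = 0)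
    (κ : G → Λ) (hκ : ∀ g h, κ g = κ h → IsConj g h) :
    ∃ e : Λ → MonoidAlgebra ℂ G, (∀ l x, x * e l = e l * x) ∧ (∀ l, e l * c l = c l) ∧
      (∀ l m, l ≠ m → e l * c m = 0) ∧
      (∀ l, ∃ t : ℂ, e l = t • ∑ g : G, single g 1 * c l * single g⁻¹ 1) ∧
      ∑ l, e l = 1 := by
  choose e he hec het using fun l => exists_central (hc l) (h l)
  have hem : ∀ l m, l ≠ m → e l * c m = 0 := by
    intro l m hlm
    obtain ⟨t, ht⟩ := het l
    rw [ht, smul_mul_assoc, Finset.sum_mul, Finset.sum_eq_zero, smul_zero]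
    intro g _
    rw [mul_assoc, mul_assoc, ← mul_assoc (c l), h' l m hlm, mul_zero]
  refine ⟨e, he, hec, hem, het, ?_⟩
  have hc0 : ∀ l, c l ≠ 0 := fun l h0 => hc l (by simp [h0])
  have key : ∀ (a : Λ → ℂ) (m : Λ), (∑ l, a l • e l) * c m = a m • c m := by
    intro a m
    rw [Finset.sum_mul, Finset.sum_eq_single m]
    · rw [smul_mul_assoc, hec]
    · intro l _ hl
      rw [smul_mul_assoc, hem l m hl, smul_zero]
    · simp
  let E : Λ → Subalgebra.center ℂ (MonoidAlgebra ℂ G) := fun l =>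
    ⟨e l, Subalgebra.mem_center_iff.2 (he l)⟩
  have hE : LinearIndependent ℂ E := by
    rw [Fintype.linearIndependent_iff]
    intro a ha m
    have h1 : ∑ l, a l • e l = 0 := by
      have := congrArg Subtype.val ha
      simpa [E] using this
    have h2 := key a m
    rw [h1, zero_mul] at h2
    exact (smul_eq_zero.1 h2.symm).resolve_right (hc0 m)
  have hspan := hE.span_eq_top_of_card_eq_finrank'
    (le_antisymm hE.fintype_card_le_finrank (finrank_center_le κ hκ))
  have h1 : (1 : Subalgebra.center ℂ (MonoidAlgebra ℂ G)) ∈ Submodule.span ℂ (Set.range E) :=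
    hspan ▸ Submodule.mem_top
  obtain ⟨a, ha⟩ := (Submodule.mem_span_range_iff_exists_fun ℂ).1 h1
  have ha' : ∑ l, a l • e l = 1 := by
    have := congrArg Subtype.val ha
    simpa [E] using this
  rw [← ha']
  refine Finset.sum_congr rfl fun m _ => ?_
  have h2 := key a m
  rw [ha', one_mul] at h2
  have : (1 - a m) • c m = 0 := by rw [sub_smul, one_smul, ← h2, sub_self]
  rw [← sub_eq_zero.1 ((smul_eq_zero.1 this).resolve_right (hc0 m)), one_smul]

/-- The image of the group algebra under an algebra homomorphism `ρ` is the product of the full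
matrix algebras of those simple modules `ℂ[G] c l` that `ρ` does not kill. -/
theorem finrank_range_eq_sum {A : Type*} [Ring A] [Algebra ℂ A]
    (hc : ∀ l, (c l).coeff 1 ≠ 0)
    (h : ∀ l x, ∃ s : ℂ, c l * x * c l = s • c l) (h' : ∀ l m, l ≠ m → ∀ x, c l * x * c m = 0)
    (κ : G → Λ) (hκ : ∀ g h, κ g = κ h → IsConj g h) (ρ : MonoidAlgebra ℂ G →ₐ[ℂ] A)
    (P : Λ → Prop) [DecidablePred P] (hP : ∀ l, P l ↔ ρ (c l) ≠ 0) :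
    Module.finrank ℂ (LinearMap.range ρ.toLinearMap) =
      ∑ l with P l, Module.finrank ℂ (Submodule.span (MonoidAlgebra ℂ G) {c l}) ^ 2 := by
  obtain ⟨e, he, hec, hem, het, hsum⟩ := exists_central_decomposition hc h h' κ hκ
  have hc0 : ∀ l, c l ≠ 0 := fun l h0 => hc l (by simp [h0])
  have hker : LinearMap.ker (actionOnSpans fun l : {l // P l} => c l) =
      LinearMap.ker ρ.toLinearMap := by
    ext b
    rw [LinearMap.mem_ker, LinearMap.mem_ker, AlgHom.toLinearMap_apply]
    constructor
    · intro hb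
      rw [← mul_one b, ← hsum, Finset.mul_sum, map_sum]
      refine Finset.sum_eq_zero fun l _ => ?_
      obtain ⟨t, ht⟩ := het l
      by_cases hl : P l
      · have : b * e l = 0 := by
          rw [ht, mul_smul_comm, Finset.mul_sum, Finset.sum_eq_zero, smul_zero]
          intro g _
          have h1 := coe_actionOnSpans_apply (fun l : {l // P l} => c l) b ⟨l, hl⟩
            ⟨single g 1 • c l, Submodule.smul_mem _ _ (Submodule.mem_span_singleton_self _)⟩
          rw [hb] at h1
          rw [← mul_assoc, ← smul_eq_mul (single g 1), ← h1]
          simp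
        rw [this, map_zero]
      · have h0 : ρ (c l) = 0 := not_not.1 fun h => hl ((hP l).2 h)
        rw [ht]
        simp [h0]
    · intro hb
      refine funext fun l => LinearMap.ext fun m => Subtype.ext ?_
      rw [coe_actionOnSpans_apply]
      exact mul_eq_zero_of_map_eq_zero ρ (h l) ((hP l).1 l.2) hb m.2
  have hsurj : Function.Surjective (actionOnSpans fun l : {l // P l} => c l) := by
    intro T
    choose b hb using fun l : {l // P l} => exists_smul_eq_of_linearMap (hc0 l) (h l) (T l)
    refine ⟨∑ l, b l * e l, funext fun l => LinearMap.ext fun m => Subtype.ext ?_⟩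
    obtain ⟨a, ha⟩ := Submodule.mem_span_singleton.1 m.2
    rw [hb, coe_actionOnSpans_apply, Submodule.coe_smul, smul_eq_mul, Finset.sum_mul,
      Finset.sum_eq_single l]
    · rw [← ha, smul_eq_mul, mul_assoc, ← mul_assoc (e l), ← he, mul_assoc, hec]
    · intro l' _ hl'
      rw [← ha, smul_eq_mul, mul_assoc, ← mul_assoc (e l'), ← he, mul_assoc,
        hem _ _ fun h => hl' (Subtype.ext h), mul_zero, mul_zero]
    · simp
  rw [Finset.sum_subtype (p := P) _ (by simp)]
  exact finrank_range_eq_sum_sq (actionOnSpans fun l : {l // P l} => c l) ρ.toLinearMap hsurj hker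

end MonoidAlgebra

/-! ### Tensor powers of matrices -/

namespace Matrix

variable {R m : Type*} [CommRing R] (n : ℕ)

/-- The matrix of the `n`-th tensor power of `A`, on the basis of pure tensors of basis vectors,
which are indexed by the words `Fin n → m`. -/
def tensorPow (A : Matrix m m R) : Matrix (Fin n → m) (Fin n → m) R :=
  Matrix.of fun f g => ∏ i, A (f i) (g i)

theorem tensorPow_apply (A : Matrix m m R) (f g : Fin n → m) :
    tensorPow n A f g = ∏ i, A (f i) (g i) := rfl

theorem tensorPow_smul (r : R) (A : Matrix m m R) :
    tensorPow n (r • A) = r ^ n • tensorPow n A := by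
  ext f g
  simp [tensorPow_apply, Finset.prod_mul_distrib]

theorem tensorPow_conjTranspose [StarRing R] (A : Matrix m m R) :
    tensorPow n Aᴴ = (tensorPow n A)ᴴ := by
  ext f g
  simp [tensorPow_apply]

theorem exists_skew_add_I_smul_skew (M : Matrix m m ℂ) :
    ∃ A B : Matrix m m ℂ, Aᴴ = -A ∧ Bᴴ = -B ∧ A + Complex.I • B = M := by
  refine ⟨(2⁻¹ : ℂ) • (M - Mᴴ), (-(Complex.I * 2⁻¹) : ℂ) • (M + Mᴴ), ?_, ?_, ?_⟩
  · simp only [Matrix.conjTranspose_smul, Matrix.conjTranspose_sub,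
      Matrix.conjTranspose_conjTranspose, ← smul_neg, neg_sub]
    simp
  · simp only [Matrix.conjTranspose_smul, Matrix.conjTranspose_add,
      Matrix.conjTranspose_conjTranspose, ← neg_smul, add_comm]
    simp
  · ext i j
    simp only [Matrix.add_apply, Matrix.smul_apply, Matrix.sub_apply, smul_eq_mul]
    linear_combination (-(2⁻¹ : ℂ)) * (M i j + Mᴴ i j) * Complex.I_mul_I

theorem linearMap_apply_eq_sum {ι : Type*} [Fintype ι] [DecidableEq ι]
    (L : Matrix ι ι ℂ →ₗ[ℂ] ℂ) (N : Matrix ι ι ℂ) :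
    L N = ∑ f, ∑ g, L (Matrix.single f g 1) * N f g := by
  conv_lhs => rw [Matrix.matrix_eq_sum_single N]
  simp only [map_sum]
  refine Finset.sum_congr rfl fun f _ => Finset.sum_congr rfl fun g _ => ?_
  have : Matrix.single f g (N f g) = N f g • Matrix.single f g (1 : ℂ) := by
    rw [Matrix.smul_single, smul_eq_mul, mul_one]
  rw [this, map_smul, smul_eq_mul, mul_comm]

theorem tensorPow_one [DecidableEq m] : tensorPow n (1 : Matrix m m R) = 1 := by
  ext f g
  rw [tensorPow_apply]
  by_cases h : f = g
  · subst h
    simp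
  · obtain ⟨i, hi⟩ := Function.ne_iff.1 h
    rw [Matrix.one_apply_ne h, Finset.prod_eq_zero (Finset.mem_univ i)]
    exact Matrix.one_apply_ne hi

variable [Fintype m]

theorem tensorPow_mul [DecidableEq m] (A B : Matrix m m R) :
    tensorPow n (A * B) = tensorPow n A * tensorPow n B := by
  ext f g
  simp only [tensorPow_apply, Matrix.mul_apply, Finset.prod_univ_sum, Fintype.piFinset_univ,
    Finset.prod_mul_distrib]

theorem trace_tensorPow [DecidableEq m] (A : Matrix m m R) :
    (tensorPow n A).trace = A.trace ^ n := by
  rw [Matrix.trace, Matrix.trace, ← Fin.prod_const, Finset.prod_univ_sum, Fintype.piFinset_univ]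
  rfl

/-! ### Polynomial functions vanishing on the unitary group -/

variable [DecidableEq m]

open scoped ComplexOrder in
theorem isUnit_det_one_sub_of_skew {S : Matrix m m ℂ} (hS : Sᴴ = -S) : IsUnit (1 - S).det := by
  have h1 : (1 + S) * (1 - S) = 1 + Sᴴ * S := by
    rw [hS]
    noncomm_ring
  have h2 : IsUnit ((1 + S) * (1 - S)) := by
    rw [h1]
    exact (Matrix.PosDef.one.add_posSemidef (Matrix.posSemidef_conjTranspose_mul_self S)).isUnit
  rw [Matrix.isUnit_iff_isUnit_det, Matrix.det_mul] at h2
  exact isUnit_of_mul_isUnit_right h2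

/-- The Cayley transform of a skew-Hermitian matrix is unitary. -/
theorem cayley_mem_unitaryGroup {S : Matrix m m ℂ} (hS : Sᴴ = -S) :
    (1 + S) * (1 - S)⁻¹ ∈ Matrix.unitaryGroup m ℂ := by
  have h1 := isUnit_det_one_sub_of_skew hS
  have h2 : IsUnit (1 + S).det := by
    have := isUnit_det_one_sub_of_skew (S := -S) (by rw [Matrix.conjTranspose_neg, hS])
    rwa [sub_neg_eq_add] at this
  rw [Matrix.mem_unitaryGroup_iff', Matrix.star_eq_conjTranspose, Matrix.conjTranspose_mul,
    Matrix.conjTranspose_nonsing_inv]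
  simp only [Matrix.conjTranspose_add, Matrix.conjTranspose_sub, Matrix.conjTranspose_one, hS,
    sub_neg_eq_add]
  have hcomm : (1 + -S) * (1 + S) = (1 + S) * (1 - S) := by noncomm_ring
  rw [Matrix.mul_assoc, ← Matrix.mul_assoc (1 + -S), hcomm, Matrix.mul_assoc (1 + S),
    Matrix.mul_nonsing_inv _ h1, Matrix.mul_one, Matrix.nonsing_inv_mul _ h2]

theorem eval_map_C_add_X_smul (t : ℂ) (A B : Matrix m m ℂ) :
    (Polynomial.evalRingHom t).mapMatrix (A.map Polynomial.C +
      (Polynomial.X : Polynomial ℂ) • B.map Polynomial.C) = A + t • B := by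
  ext i j
  change Polynomial.eval t (Polynomial.C (A i j) + Polynomial.X * Polynomial.C (B i j)) =
    A i j + t * B i j
  simp only [Polynomial.eval_add, Polynomial.eval_mul, Polynomial.eval_C, Polynomial.eval_X]

/-- If a linear functional of `A ↦ tensorPow n A` vanishes on the unitary group, it vanishes
on the numerators of all Cayley transforms: for skew-Hermitian matrices by homogeneity, hence for
all matrices, because skew-Hermitian matrices are a real form of all matrices. -/
theorem map_tensorPow_cayley_eq_zero {L : Matrix (Fin n → m) (Fin n → m) ℂ →ₗ[ℂ] ℂ}
    (hL : ∀ U ∈ Matrix.unitaryGroup m ℂ, L (tensorPow n U) = 0) (M : Matrix m m ℂ) :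
    L (tensorPow n ((1 + M) * (1 - M).adjugate)) = 0 := by
  have hskew : ∀ S : Matrix m m ℂ, Sᴴ = -S →
      L (tensorPow n ((1 + S) * (1 - S).adjugate)) = 0 := by
    intro S hS
    have h1 := isUnit_det_one_sub_of_skew hS
    have h2 : (1 + S) * (1 - S).adjugate = (1 - S).det • ((1 + S) * (1 - S)⁻¹) := by
      rw [Matrix.inv_def, Matrix.mul_smul, smul_smul, Ring.mul_inverse_cancel _ h1, one_smul]
    rw [h2, tensorPow_smul, map_smul, hL _ (cayley_mem_unitaryGroup hS), smul_zero]
  obtain ⟨A, B, hA, hB, hM⟩ := exists_skew_add_I_smul_skew M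
  -- The value at `A + t • B`, as a polynomial in `t`.
  let P : Matrix m m (Polynomial ℂ) :=
    (1 + A).map Polynomial.C + (Polynomial.X : Polynomial ℂ) • B.map Polynomial.C
  let Q : Matrix m m (Polynomial ℂ) :=
    (1 - A).map Polynomial.C + (Polynomial.X : Polynomial ℂ) • (-B).map Polynomial.C
  let q : Polynomial ℂ := ∑ f, ∑ g, Polynomial.C (L (Matrix.single f g 1)) *
    ∏ i, (P * Q.adjugate) (f i) (g i)
  have hq : ∀ t : ℂ, q.eval t =
      L (tensorPow n ((1 + (A + t • B)) * (1 - (A + t • B)).adjugate)) := by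
    intro t
    have h1 : (Polynomial.evalRingHom t).mapMatrix (P * Q.adjugate) =
        (1 + (A + t • B)) * (1 - (A + t • B)).adjugate := by
      rw [map_mul, RingHom.map_adjugate, eval_map_C_add_X_smul, eval_map_C_add_X_smul, add_assoc,
        smul_neg, ← sub_eq_add_neg, sub_sub]
    rw [← h1, linearMap_apply_eq_sum L]
    simp only [q, Polynomial.eval_finsetSum, Polynomial.eval_mul, Polynomial.eval_C,
      Polynomial.eval_prod]
    rfl
  have hq0 : q = 0 := by
    refine Polynomial.eq_zero_of_infinite_isRoot q ?_
    refine (Set.infinite_range_of_injective Complex.ofReal_injective).mono ?_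
    rintro _ ⟨t, rfl⟩
    change q.eval (t : ℂ) = 0
    rw [hq]
    refine hskew _ ?_
    rw [Matrix.conjTranspose_add, Matrix.conjTranspose_smul, hA, hB]
    simp [add_comm]
  rw [← hM, ← hq, hq0, Polynomial.eval_zero]

/-- The unitary trick: a linear functional of `A ↦ tensorPow n A` that vanishes on the unitary
group vanishes identically. -/
theorem map_tensorPow_eq_zero {L : Matrix (Fin n → m) (Fin n → m) ℂ →ₗ[ℂ] ℂ}
    (hL : ∀ U ∈ Matrix.unitaryGroup m ℂ, L (tensorPow n U) = 0) (A : Matrix m m ℂ) :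
    L (tensorPow n A) = 0 := by
  -- A matrix for which `1 + A` is invertible is a multiple of a Cayley transform.
  have h1 : ∀ A : Matrix m m ℂ, (1 + A).det ≠ 0 → L (tensorPow n A) = 0 := by
    intro A hA
    have hu : IsUnit (1 + A).det := isUnit_iff_ne_zero.2 hA
    set Y := (1 + A)⁻¹ with hY
    have hAY : A * Y = 1 - Y := by
      rw [eq_sub_iff_add_eq, ← Matrix.mul_nonsing_inv _ hu, ← hY, Matrix.add_mul, Matrix.one_mul,
        add_comm]
    have h2 := map_tensorPow_cayley_eq_zero n hL (1 - (2 : ℂ) • Y)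
    have h3 : (1 + (1 - (2 : ℂ) • Y)) * (1 - (1 - (2 : ℂ) • Y)).adjugate =
        ((2 : ℂ) • Y).det • A := by
      have h4 : 1 + (1 - (2 : ℂ) • Y) = A * ((2 : ℂ) • Y) := by
        rw [Matrix.mul_smul, hAY, two_smul, two_smul]
        abel
      rw [h4, sub_sub_cancel, Matrix.mul_assoc, Matrix.mul_adjugate, Matrix.mul_smul,
        Matrix.mul_one]
    rw [h3, tensorPow_smul, map_smul, smul_eq_zero] at h2
    refine h2.resolve_left (pow_ne_zero _ ?_)
    rw [Matrix.det_smul]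
    refine mul_ne_zero (pow_ne_zero _ two_ne_zero) ?_
    rw [hY, Matrix.det_nonsing_inv]
    exact hu.ringInverse.ne_zero
  have hcont : Continuous fun t : ℂ => (1 + t • A).det := by fun_prop
  have hev : ∀ᶠ t in nhdsWithin (0 : ℂ) {0}ᶜ, (1 + t • A).det ≠ 0 :=
    (hcont.continuousAt.eventually_ne (by simp)).filter_mono nhdsWithin_le_nhds
  obtain ⟨t, ht, ht0⟩ := (hev.and self_mem_nhdsWithin).exists
  have h2 := h1 (t • A) ht
  rw [tensorPow_smul, map_smul, smul_eq_zero] at h2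
  exact h2.resolve_left (pow_ne_zero _ ht0)

end Matrix

/-! ### Symmetric tensors are spanned by tensor powers -/

theorem exists_perm_comp_eq {α β : Type*} [Fintype α] [DecidableEq β] (h h' : α → β)
    (H : ∀ b, Fintype.card {a // h a = b} = Fintype.card {a // h' a = b}) :
    ∃ σ : Equiv.Perm α, h' ∘ σ = h :=
  ⟨Equiv.ofFiberEquiv fun b => Fintype.equivOfCardEq (H b),
    funext fun a => Equiv.ofFiberEquiv_map _ a⟩

/-- If the form `∑ c h * ∏ x (h i)` vanishes identically, then the sum of the `c h` over each orbit
of the symmetric group is zero, being a coefficient of the corresponding polynomial. -/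
theorem sum_mul_eq_zero_of_symmetric {α : Type*} [Fintype α] [DecidableEq α] {n : ℕ}
    (c T : (Fin n → α) → ℂ) (hc : ∀ x : α → ℂ, ∑ h, c h * ∏ i, x (h i) = 0)
    (hT : ∀ h (σ : Equiv.Perm (Fin n)), T (h ∘ σ) = T h) : ∑ h, c h * T h = 0 := by
  classical
  let e : (Fin n → α) → (α →₀ ℕ) := fun h => ∑ i, Finsupp.single (h i) 1
  have he : ∀ h b, e h b = Fintype.card {i // h i = b} := by
    intro h b
    simp only [e, Finsupp.finsetSum_apply, Finsupp.single_apply, Fintype.card_subtype,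
      Finset.card_filter]
  let p : MvPolynomial α ℂ := ∑ h, MvPolynomial.monomial (e h) (c h)
  have hp : p = 0 := by
    refine MvPolynomial.funext fun x => ?_
    rw [map_zero, ← hc x, map_sum]
    refine Finset.sum_congr rfl fun h _ => ?_
    rw [MvPolynomial.eval_monomial, Finsupp.prod_fintype _ _ (by simp)]
    congr 1
    simp only [he, Fintype.card_subtype]
    rw [← Finset.prod_fiberwise' Finset.univ h x]
    simp only [Finset.prod_const]
  have hcoeff : ∀ k, ∑ h with e h = k, c h = 0 := by
    intro k
    have := congrArg (MvPolynomial.coeff k) hp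
    simpa [p, MvPolynomial.coeff_sum, MvPolynomial.coeff_monomial, Finset.sum_filter] using this
  rw [← Finset.sum_fiberwise_of_maps_to (t := Finset.univ.image e)
    (fun h _ => Finset.mem_image_of_mem e (Finset.mem_univ h))]
  refine Finset.sum_eq_zero fun k hk => ?_
  obtain ⟨h₀, -, rfl⟩ := Finset.mem_image.1 hk
  have : ∀ h ∈ Finset.univ.filter (fun h => e h = e h₀), c h * T h = c h * T h₀ := by
    intro h hh
    have hh' := (Finset.mem_filter.1 hh).2
    obtain ⟨σ, hσ⟩ := exists_perm_comp_eq h h₀ fun b => by rw [← he, ← he, hh']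
    rw [← hσ, hT]
  rw [Finset.sum_congr rfl this, ← Finset.sum_mul, hcoeff, zero_mul]

/-! ### Schur–Weyl duality -/

section SchurWeyl

variable {n : ℕ} {m : Type*}

/-- The action of the symmetric group on tensors by permutation of the tensor factors. -/
def permAction (n : ℕ) (m : Type*) :
    Equiv.Perm (Fin n) →* Module.End ℂ ((Fin n → m) → ℂ) where
  toFun g := LinearMap.funLeft ℂ ℂ fun f => f ∘ g
  map_one' := rfl
  map_mul' _ _ := rfl

/-- The action of the group algebra of the symmetric group on tensors. -/
noncomputable def tensorAction (n : ℕ) (m : Type*) :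
    MonoidAlgebra ℂ (Equiv.Perm (Fin n)) →ₐ[ℂ] Module.End ℂ ((Fin n → m) → ℂ) :=
  MonoidAlgebra.lift ℂ _ _ (permAction n m)

theorem tensorAction_single (g : Equiv.Perm (Fin n)) (r : ℂ) (w : (Fin n → m) → ℂ)
    (f : Fin n → m) : tensorAction n m (MonoidAlgebra.single g r) w f = r * w (f ∘ g) := by
  rw [tensorAction, MonoidAlgebra.lift_single]
  rfl

theorem toLin'_tensorPow_comm_tensorAction [Fintype m] [DecidableEq m] (A : Matrix m m ℂ)
    (x : MonoidAlgebra ℂ (Equiv.Perm (Fin n))) :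
    tensorAction n m x * Matrix.toLin' (A.tensorPow n) =
      Matrix.toLin' (A.tensorPow n) * tensorAction n m x := by
  induction x using MonoidAlgebra.induction_on with
  | of g =>
    refine LinearMap.ext fun w => funext fun f => ?_
    rw [MonoidAlgebra.of_apply, Module.End.mul_apply, Module.End.mul_apply, tensorAction_single,
      one_mul, Matrix.toLin'_apply, Matrix.toLin'_apply]
    simp only [Matrix.mulVec, dotProduct, tensorAction_single, one_mul]
    refine (Fintype.sum_equiv (Equiv.arrowCongr g⁻¹ (Equiv.refl m)) _ _ fun f' => ?_).symm
    have h : (Equiv.arrowCongr g⁻¹ (Equiv.refl m)) f' = f' ∘ g := rfl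
    rw [h]
    congr 1
    exact (Equiv.prod_comp g fun i => A (f i) (f' i)).symm
  | add x y hx hy => rw [map_add, add_mul, mul_add, hx, hy]
  | smul r x hx => rw [map_smul, smul_mul_assoc, mul_smul_comm, hx]

variable [Fintype m] [DecidableEq m]

/-- A functional vanishing on the tensor powers of unitary matrices vanishes on all matrices
invariant under simultaneous permutation of the tensor factors. -/
theorem map_eq_zero_of_symmetric {L : Matrix (Fin n → m) (Fin n → m) ℂ →ₗ[ℂ] ℂ}
    (hL : ∀ U ∈ Matrix.unitaryGroup m ℂ, L (U.tensorPow n) = 0)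
    {T : Matrix (Fin n → m) (Fin n → m) ℂ}
    (hT : ∀ f g (σ : Equiv.Perm (Fin n)), T (f ∘ σ) (g ∘ σ) = T f g) : L T = 0 := by
  let e := Equiv.arrowProdEquivProdArrow (Fin n) (fun _ => m) (fun _ => m)
  have key : ∀ N : Matrix (Fin n → m) (Fin n → m) ℂ,
      L N = ∑ h, L (Matrix.single (e h).1 (e h).2 1) * N (e h).1 (e h).2 := by
    intro N
    rw [Matrix.linearMap_apply_eq_sum, ← Fintype.sum_prod_type']
    exact (Equiv.sum_comp e fun p => L (Matrix.single p.1 p.2 1) * N p.1 p.2).symm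
  rw [key]
  refine sum_mul_eq_zero_of_symmetric (α := m × m) _ (fun h => T (e h).1 (e h).2)
    (fun x => ?_) fun h σ => hT (e h).1 (e h).2 σ
  rw [← Matrix.map_tensorPow_eq_zero n hL (Matrix.of fun i j => x (i, j)), key]
  rfl

/-- Schur–Weyl duality: an operator on tensors commuting with all `U ⊗ ⋯ ⊗ U`, for `U` unitary,
is in the image of the group algebra of the symmetric group. -/
theorem mem_range_tensorAction {X : Matrix (Fin n → m) (Fin n → m) ℂ}
    (hX : ∀ U ∈ Matrix.unitaryGroup m ℂ, X * U.tensorPow n = U.tensorPow n * X) :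
    Matrix.toLin' X ∈ LinearMap.range (tensorAction n m).toLinearMap := by
  have hcomm : ∀ T : Matrix (Fin n → m) (Fin n → m) ℂ,
      (∀ f g (σ : Equiv.Perm (Fin n)), T (f ∘ σ) (g ∘ σ) = T f g) → X * T = T * X := by
    intro T hT
    ext a b
    rw [← sub_eq_zero]
    refine map_eq_zero_of_symmetric (L := (Matrix.entryLinearMap ℂ ℂ a b) ∘ₗ
      (LinearMap.mulLeft ℂ X - LinearMap.mulRight ℂ X)) (fun U hU => ?_) hT
    simp [hX U hU]
  let _ : Module (MonoidAlgebra ℂ (Equiv.Perm (Fin n))) ((Fin n → m) → ℂ) :=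
    Module.compHom _ (tensorAction n m).toRingHom
  have hsmul : ∀ (b : MonoidAlgebra ℂ (Equiv.Perm (Fin n))) (w : (Fin n → m) → ℂ),
      b • w = tensorAction n m b w := fun _ _ => rfl
  have : IsScalarTower ℂ (MonoidAlgebra ℂ (Equiv.Perm (Fin n))) ((Fin n → m) → ℂ) :=
    ⟨fun r b w => by rw [hsmul, hsmul, map_smul]; rfl⟩
  obtain ⟨b, hb⟩ := exists_smul_eq_of_commute_end (k := ℂ)
    (B := MonoidAlgebra ℂ (Equiv.Perm (Fin n))) (Matrix.toLin' X) fun φ w => by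
      -- The matrix of `φ` is invariant under permutation of the tensor factors.
      let φ' : Module.End ℂ ((Fin n → m) → ℂ) := φ.restrictScalars ℂ
      have h1 := hcomm (LinearMap.toMatrix' φ') fun f g σ => by
        rw [LinearMap.toMatrix'_apply, LinearMap.toMatrix'_apply]
        have h2 : (MonoidAlgebra.single σ (1 : ℂ)) •
            (Pi.single (g ∘ σ) 1 : (Fin n → m) → ℂ) = Pi.single g 1 := by
          refine funext fun f' => ?_
          rw [hsmul, tensorAction_single, one_mul, Pi.single_apply, Pi.single_apply]
          simp only [σ.surjective.injective_comp_right.eq_iff]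
        rw [← h2]
        change φ _ _ = φ _ _
        rw [map_smul, hsmul, tensorAction_single, one_mul]
      have h3 := congrArg (fun M => Matrix.toLin' M w) h1
      simpa [Matrix.toLin'_mul, φ'] using h3
  exact ⟨b, LinearMap.ext fun w => (hb w).symm⟩

theorem mem_range_tensorAction_iff {X : Matrix (Fin n → m) (Fin n → m) ℂ} :
    Matrix.toLin' X ∈ LinearMap.range (tensorAction n m).toLinearMap ↔
      ∀ U ∈ Matrix.unitaryGroup m ℂ, X * U.tensorPow n = U.tensorPow n * X := by
  refine ⟨?_, mem_range_tensorAction⟩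
  rintro ⟨x, hx⟩ U -
  refine Matrix.toLin'.injective ?_
  rw [Matrix.toLin'_mul, Matrix.toLin'_mul, ← hx]
  exact toLin'_tensorPow_comm_tensorAction U x

end SchurWeyl

/-! ### Young symmetrizers acting on tensors -/

namespace YoungNumbering

variable {n : ℕ} {μ : YoungDiagram}

/-- A word in fewer than `μ.colLen 0` letters repeats a letter in the first column. -/
theorem tensorAction_columnSum_eq_zero (T : YoungNumbering n μ) {d : ℕ} (h : d < μ.colLen 0) :
    tensorAction n (Fin d) T.columnSum = 0 := by
  refine LinearMap.ext fun w => funext fun f => ?_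
  obtain ⟨i, hi, j, hj, hij, hf⟩ := Finset.exists_ne_map_eq_of_card_lt_of_maps_to
    (s := Finset.univ.filter fun i => (T i).1.2 = 0) (t := Finset.univ) (f := f)
    (by rwa [T.card_col_eq, Finset.card_univ, Fintype.card_fin]) (fun _ _ => Finset.mem_univ _)
  rw [Finset.mem_filter] at hi hj
  have h1 := T.single_swap_mul_columnSum hij (hi.2.trans hj.2.symm)
  have h2 : tensorAction n (Fin d) (MonoidAlgebra.single (Equiv.swap i j) 1 * T.columnSum) w f =
      tensorAction n (Fin d) T.columnSum w f := by
    have hfs : f ∘ Equiv.swap i j = f := by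
      have hu : Function.update f j (f i) = f := Function.update_eq_self_iff.2 hf
      rw [Equiv.comp_swap_eq_update, ← hf, hu, Function.update_eq_self]
    rw [map_mul, Module.End.mul_apply, tensorAction_single, one_mul, hfs]
  rw [h1, map_neg] at h2
  simpa using self_eq_neg.1 h2.symm

/-- On the word that labels each cell by its row, the only column permutation that contributes to
the diagonal coefficient of the Young symmetrizer is the identity, so nothing cancels. -/
theorem tensorAction_youngSymmetrizer_ne_zero (T : YoungNumbering n μ) {d : ℕ}
    (h : μ.colLen 0 ≤ d) : tensorAction n (Fin d) T.youngSymmetrizer ≠ 0 := by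
  classical
  have hrow : ∀ i, (T i).1.1 < d := fun i =>
    (YoungDiagram.mem_iff_lt_colLen.1
      (μ.up_left_mem le_rfl (Nat.zero_le _) ((YoungDiagram.mem_cells _).1 (T i).2))).trans_le h
  let f : Fin n → Fin d := fun i => ⟨(T i).1.1, hrow i⟩
  have hf : ∀ σ : Equiv.Perm (Fin n), f ∘ σ = f ↔ σ ∈ T.rowStabilizer := fun σ => by
    simp only [funext_iff, f, Function.comp_apply, Fin.mk.injEq]
    rfl
  intro h0
  have h1 := congrFun (LinearMap.congr_fun h0 (Pi.single f 1)) f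
  rw [youngSymmetrizer, Finset.sum_mul_sum] at h1
  simp only [MonoidAlgebra.single_mul_single, one_mul, map_sum, LinearMap.sum_apply,
    Finset.sum_apply, tensorAction_single, LinearMap.zero_apply, Pi.zero_apply] at h1
  have h2 : ∀ σ : T.rowStabilizer, ∑ τ : T.columnStabilizer,
      (((Equiv.Perm.sign (τ : Equiv.Perm (Fin n)) : ℤˣ) : ℤ) : ℂ) *
        (Pi.single f 1 : (Fin n → Fin d) → ℂ)
          (f ∘ ⇑((σ : Equiv.Perm (Fin n)) * (τ : Equiv.Perm (Fin n)))) = 1 := by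
    intro σ
    rw [Finset.sum_eq_single 1]
    · have := (hf σ).2 σ.2
      rw [Subgroup.coe_one, mul_one, this]
      simp
    · intro τ _ hτ
      rw [Pi.single_eq_of_ne, mul_zero]
      rw [Ne, hf, Subgroup.mul_mem_cancel_left _ σ.2]
      exact fun h => hτ (Subtype.ext
        (T.eq_one_of_mem_rowStabilizer_of_mem_columnStabilizer h τ.2))
    · simp
  rw [Finset.sum_congr rfl fun σ _ => h2 σ] at h1
  simp at h1

theorem tensorAction_youngSymmetrizer_ne_zero_iff (T : YoungNumbering n μ) (d : ℕ) :
    tensorAction n (Fin d) T.youngSymmetrizer ≠ 0 ↔ μ.colLen 0 ≤ d := by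
  refine ⟨fun h => not_lt.1 fun hlt => h ?_, T.tensorAction_youngSymmetrizer_ne_zero⟩
  rw [youngSymmetrizer_eq, map_mul, T.tensorAction_columnSum_eq_zero hlt, mul_zero]

end YoungNumbering

/-- The Wedderburn decomposition of the image of the group algebra: the simple modules that occur
in the tensor power are the Specht modules of shapes with at most `d` rows. -/
theorem finrank_range_tensorAction (n d : ℕ) :
    Module.finrank ℂ (LinearMap.range (tensorAction n (Fin d)).toLinearMap) =
      ∑ p : n.Partition with Multiset.card p.parts ≤ d,
        Module.finrank ℂ p.spechtModule ^ 2 := by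
  refine MonoidAlgebra.finrank_range_eq_sum
    (c := fun p : n.Partition => p.rowNumbering.youngSymmetrizer)
    (fun p => by simp [YoungNumbering.coeff_youngSymmetrizer_one])
    (fun p => p.rowNumbering.youngSymmetrizer_mul_mul_self)
    (fun p q hpq => p.rowNumbering.youngSymmetrizer_mul_mul_eq_zero q.rowNumbering
      fun h => hpq (Nat.Partition.youngDiagram_injective h))
    (fun σ => ⟨σ.partition.parts, σ.partition.parts_pos,
      σ.partition.parts_sum.trans (Fintype.card_fin n)⟩) (fun σ τ h => ?_) _ _ fun p => ?_
  · have h' := congrArg Nat.Partition.parts h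
    exact Equiv.Perm.partition_eq_of_isConj.2 (Nat.Partition.ext h')
  · rw [YoungNumbering.tensorAction_youngSymmetrizer_ne_zero_iff,
      Nat.Partition.colLen_youngDiagram_zero]

/-! ### Integration over a compact group -/

section Haar

variable {G J : Type*} [Group G] [TopologicalSpace G] [IsTopologicalGroup G] [CompactSpace G]
  [MeasurableSpace G] [BorelSpace G] [Fintype J] [DecidableEq J]

/-- The fixed vectors of a matrix representation. -/
def fixedVectors (N : G →* Matrix J J ℂ) : Submodule ℂ (J → ℂ) where
  carrier := {x | ∀ g, Matrix.mulVec (N g) x = x}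
  add_mem' hx hy g := by rw [Matrix.mulVec_add, hx g, hy g]
  zero_mem' g := Matrix.mulVec_zero _
  smul_mem' r x hx g := by rw [Matrix.mulVec_smul, hx g]

/-- The integral of a character is the dimension of the space of fixed vectors: averaging the
representation gives a projection onto that space. -/
theorem integral_trace_eq_finrank_fixedVectors (μ : Measure G) [IsProbabilityMeasure μ]
    [μ.IsMulLeftInvariant] (N : G →* Matrix J J ℂ) (hN : Continuous N) :
    ∫ g, (N g).trace ∂μ = Module.finrank ℂ (fixedVectors N) := by
  have hint : ∀ f : G → ℂ, Continuous f → Integrable f μ := fun f hf =>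
    hf.integrable_of_hasCompactSupport (HasCompactSupport.of_compactSpace f)
  have hcont : ∀ a b, Continuous fun g => N g a b := fun a b => hN.matrix_elem a b
  let Q : Matrix J J ℂ := Matrix.of fun a b => ∫ g, N g a b ∂μ
  have hQ : ∀ h, N h * Q = Q := by
    intro h
    ext a b
    have h1 : ∀ c, N h a c * Q c b = ∫ g, N h a c * N g c b ∂μ := fun c =>
      (integral_const_mul _ _).symm
    have h3 : ∀ c ∈ Finset.univ, Integrable (fun g => N h a c * N g c b) μ := fun c _ =>
      hint _ (continuous_const.mul (hcont c b))
    rw [Matrix.mul_apply, Finset.sum_congr rfl fun c _ => h1 c, ← integral_finsetSum _ h3]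
    have h2 : ∀ g, ∑ c, N h a c * N g c b = N (h * g) a b := fun g => by
      rw [map_mul, Matrix.mul_apply]
    simp only [h2]
    exact integral_mul_left_eq_self (fun g => N g a b) h
  have hproj : LinearMap.IsProj (fixedVectors N) (Matrix.toLin' Q) := by
    refine ⟨fun x h => ?_, fun x hx => ?_⟩
    · rw [Matrix.toLin'_apply, Matrix.mulVec_mulVec, hQ]
    · ext a
      rw [Matrix.toLin'_apply, Matrix.mulVec, dotProduct]
      have h1 : ∀ b, Q a b * x b = ∫ g, N g a b * x b ∂μ := fun b =>
        (integral_mul_const _ _).symm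
      have h3 : ∀ b ∈ Finset.univ, Integrable (fun g => N g a b * x b) μ := fun b _ =>
        hint _ ((hcont a b).mul continuous_const)
      rw [Finset.sum_congr rfl fun b _ => h1 b, ← integral_finsetSum _ h3]
      have h2 : ∀ g, ∑ b, N g a b * x b = x a := fun g => congrFun (hx g) a
      simp [h2]
  rw [← hproj.trace, Matrix.trace_toLin'_eq, Matrix.trace]
  simp only [Matrix.trace]
  exact integral_finsetSum _ fun a _ => hint _ (hcont a a)

end Haar

/-! ### The moments of the trace -/

namespace UnitaryGroup

instance instIsMulLeftInvariantHaar (d : ℕ) : (haar d).IsMulLeftInvariant := by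
  unfold haar
  infer_instance

open scoped Kronecker Matrix

/-- The conjugation action of the unitary group on operators on the `n`-th tensor power, written
on vectorized matrices. -/
def conjTensorPow (n d : ℕ) :
    UnitaryGroup d →* Matrix ((Fin n → Fin d) × (Fin n → Fin d))
      ((Fin n → Fin d) × (Fin n → Fin d)) ℂ where
  toFun U := (U.1.tensorPow n).map star ⊗ₖ U.1.tensorPow n
  map_one' := by
    simp [Matrix.tensorPow_one]
  map_mul' U V := by
    rw [← Matrix.mul_kronecker_mul, ← Matrix.tensorPow_mul]
    congr 1
    rw [Submonoid.coe_mul, Matrix.tensorPow_mul]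
    exact Matrix.map_mul (f := starRingEnd ℂ)

theorem continuous_conjTensorPow (n d : ℕ) : Continuous (conjTensorPow n d) := by
  refine continuous_matrix fun a b => ?_
  have h : ∀ f g : Fin n → Fin d,
      Continuous fun U : UnitaryGroup d => U.1.tensorPow n f g := fun f g => by
    simp only [Matrix.tensorPow_apply]
    exact continuous_finsetProd _ fun i _ => continuous_subtype_val.matrix_elem _ _
  exact (h a.1 b.1).star.mul (h a.2 b.2)

/-- The character of the conjugation action is the `2 * n`-th power of the absolute trace. -/
theorem trace_conjTensorPow (n d : ℕ) (U : UnitaryGroup d) :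
    (conjTensorPow n d U).trace = ((‖U.1.trace‖ ^ (2 * n) : ℝ) : ℂ) := by
  have h : (conjTensorPow n d U).trace = star (U.1.trace ^ n) * U.1.trace ^ n := by
    rw [← Matrix.trace_tensorPow]
    change ((U.1.tensorPow n).map star ⊗ₖ U.1.tensorPow n).trace = _
    rw [Matrix.trace_kronecker, ← Matrix.trace_conjTranspose]
    rfl
  rw [h, Complex.star_def, Complex.conj_mul', norm_pow, ← Complex.ofReal_pow, ← pow_mul,
    mul_comm n]

/-- The fixed points of the conjugation action are the operators commuting with all unitary
tensor powers, that is, the image of the group algebra of the symmetric group. -/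
theorem finrank_fixedVectors_conjTensorPow (n d : ℕ) :
    Module.finrank ℂ (fixedVectors (conjTensorPow n d)) =
      Module.finrank ℂ (LinearMap.range (tensorAction n (Fin d)).toLinearMap) := by
  let v : Matrix (Fin n → Fin d) (Fin n → Fin d) ℂ ≃ₗ[ℂ]
      ((Fin n → Fin d) × (Fin n → Fin d) → ℂ) :=
    LinearEquiv.ofBijective
      { toFun := Matrix.vec
        map_add' := Matrix.vec_add
        map_smul' := Matrix.vec_smul } Matrix.vec_bijective
  have hv : ∀ X, v X = X.vec := fun _ => rfl
  suffices h : fixedVectors (conjTensorPow n d) =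
      Submodule.map (Matrix.toLin'.symm.trans v : _ →ₗ[ℂ] _)
        (LinearMap.range (tensorAction n (Fin d)).toLinearMap) by
    rw [h]
    exact LinearEquiv.finrank_map_eq _ _
  ext x
  rw [Submodule.mem_map_equiv]
  obtain ⟨X, rfl⟩ := v.surjective x
  have h1 : (Matrix.toLin'.symm.trans v).symm (v X) = Matrix.toLin' X := by simp
  rw [h1, mem_range_tensorAction_iff]
  change (∀ U : UnitaryGroup d, _) ↔ _
  rw [Subtype.forall]
  refine forall_congr' fun U => forall_congr' fun hU => ?_
  change ((U.tensorPow n).map star ⊗ₖ U.tensorPow n).mulVec (v X) = v X ↔ _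
  rw [hv, Matrix.kronecker_mulVec_vec, Matrix.vec_inj]
  have h2 : ((U.tensorPow n).map star)ᵀ = Uᴴ.tensorPow n :=
    (Matrix.tensorPow_conjTranspose n U).symm
  rw [Matrix.mem_unitaryGroup_iff, Matrix.star_eq_conjTranspose] at hU
  have h3 : U.tensorPow n * Uᴴ.tensorPow n = 1 := by
    rw [← Matrix.tensorPow_mul, hU, Matrix.tensorPow_one]
  have h4 : Uᴴ.tensorPow n * U.tensorPow n = 1 := mul_eq_one_comm.1 h3
  rw [h2]
  constructor
  · intro h
    nth_rewrite 1 [← h]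
    rw [Matrix.mul_assoc, h4, Matrix.mul_one]
  · intro h
    rw [← h, Matrix.mul_assoc, h3, Matrix.mul_one]

end UnitaryGroup

theorem mainTheorem1 (n d : ℕ) :
    ∫ U : UnitaryGroup d, ‖Matrix.trace (U : Matrix (Fin d) (Fin d) ℂ)‖ ^ (2 * n)
        ∂(UnitaryGroup.haar d) =
      ∑ p : n.Partition with Multiset.card p.parts ≤ d,
        (Module.finrank ℂ p.spechtModule : ℝ) ^ 2 := by
  have h1 := integral_trace_eq_finrank_fixedVectors (UnitaryGroup.haar d)
    (UnitaryGroup.conjTensorPow n d) (UnitaryGroup.continuous_conjTensorPow n d)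
  simp only [UnitaryGroup.trace_conjTensorPow] at h1
  rw [integral_complex_ofReal, UnitaryGroup.finrank_fixedVectors_conjTensorPow,
    finrank_range_tensorAction] at h1
  exact_mod_cast h1
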